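/- Let $n\ge 1$ and $\lambda_p,\lambda_d,r_d>0$. Let $\Phi$ be the Matérn cluster process on $\mathbb{R}^n$ with these parameters: the parent points $X_1,X_2,\dots$ form a homogeneous Poisson point process of intensity $\lambda_p$ on $\mathbb{R}^n$; the daughter processes $\Psi_1,\Psi_2,\dots$ are i.i.d. Poisson point processes with density $\lambda_d\mathbf 1(\|y\|\le r_d)$, independent of the parent points; and $\Phi=\bigcup_i (X_i+\Psi_i)$. For $k\ge1$ let $R_k$ be the $k$th contact distance of $\Phi$, i.e. the distance from an arbitrary fixed location $u\in\mathbb{R}^n$ to the $k$th closest point of $\Phi$, and let $F_{R_k}(r)=\mathbb{P}[R_k\le r]$ be its CDF. Let $v_n=\pi^{n/2}/\Gamma(\frac n2+1)$ be the volume of the unit ball of $\mathbb{R}^n$, let $\mathcal{A}(r,r_d,x)$ be the volume of the intersection of two balls of $\mathbb{R}^n$ with radii $r$ and $r_d$ whose centres are at distance $x$, and for $k=0,1,2$ put $$h_k(r)=\frac{\lambda_p\, n\, v_n}{k!}\int_0^{r+r_d}\bigl(\lambda_d\mathcal{A}(r,r_d,x)\bigr)^k e^{-\lambda_d\mathcal{A}(r,r_d,x)}\,x^{n-1}\,\mathrm{d}x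 .$$ Then for every $r\ge 0$, $$F_{R_1}(r)=1-e^{h_0(r)-\lambda_p v_n (r+r_d)^n},$$ $$F_{R_2}(r)=1-e^{h_0(r)-\lambda_p v_n (r+r_d)^n}\bigl(1+h_1(r)\bigr),$$ $$F_{R_3}(r)=F_{R_2}(r)-e^{h_0(r)-\lambda_p v_n (r+r_d)^n}\Bigl(h_2(r)+\frac{h_1(r)^2}{2}\Bigr).$$ -/

import Mathlib

open MeasureTheory ProbabilityTheory Set
open scoped ENNReal NNReal

noncomputable section

namespace Matern

/-- `ℝⁿ` with the Euclidean norm and Lebesgue measure. -/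
abbrev Space (n : ℕ) : Type := EuclideanSpace ℝ (Fin n)

/-- A point process on `ℝⁿ`: a random measure which almost surely is a locally finite counting
measure, i.e. assigns a natural number to every bounded Borel set. -/
structure IsPointProcess {n : ℕ} {Ω : Type*} [MeasurableSpace Ω]
    (P : Measure Ω) (N : Ω → Measure (Space n)) : Prop where
  measurable : Measurable N
  counting : ∀ᵐ ω ∂P, ∀ B : Set (Space n), MeasurableSet B → Bornology.IsBounded B →
    ∃ m : ℕ, N ω B = (m : ℝ≥0∞)

/-- A Poisson point process on `ℝⁿ` with intensity measure `Λ`: the number of points in a Borel set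
of finite intensity is Poisson distributed, and the numbers of points in disjoint Borel sets are
independent. -/
structure IsPoissonProcess {n : ℕ} {Ω : Type*} [MeasurableSpace Ω]
    (P : Measure Ω) (N : Ω → Measure (Space n)) (Λ : Measure (Space n)) : Prop
    extends IsPointProcess P N where
  law : ∀ B : Set (Space n), MeasurableSet B → Λ B < ∞ →
    P.map (fun ω => N ω B) =
      (poissonMeasure (Λ B).toNNReal).map (fun m : ℕ => (m : ℝ≥0∞))
  indep : ∀ (m : ℕ) (B : Fin m → Set (Space n)), (∀ i, MeasurableSet (B i)) →
    Pairwise (Function.onFun Disjoint B) → iIndepFun (fun i ω => N ω (B i)) P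

/-- `Φ` (as a random counting measure) is a Matérn cluster process on `ℝⁿ` with parent intensity
`lp`, daughter density `ld` and cluster radius `rd`. Here `X i` are the points of the parent
process, which is a homogeneous Poisson process of intensity `lp` (it has almost surely infinitely
many points when `lp > 0` and `n ≥ 1`, so that they are enumerated by `ℕ`); the daughter processes
`Ψ i` are independent Poisson processes of density `ld` confined to the ball of radius `rd` about
the origin, jointly independent of the parents; and `Φ` is the superposition of the daughter
processes `Ψ i` translated by `X i`. -/
def IsMaternClusterProcess {n : ℕ} {Ω : Type*} [MeasurableSpace Ω]
    (P : Measure Ω) (lp ld rd : ℝ) (Φ : Ω → Measure (Space n)) : Prop :=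
  ∃ (X : ℕ → Ω → Space n) (Ψ : ℕ → Ω → Measure (Space n)),
    (∀ i, Measurable (X i)) ∧
    IsPoissonProcess P (fun ω => Measure.sum (fun i => Measure.dirac (X i ω)))
      (ENNReal.ofReal lp • volume) ∧
    (∀ i, IsPoissonProcess P (Ψ i)
      (ENNReal.ofReal ld • volume.restrict (Metric.closedBall 0 rd))) ∧
    iIndepFun Ψ P ∧
    IndepFun (fun ω i => X i ω) (fun ω i => Ψ i ω) P ∧
    ∀ᵐ ω ∂P, Φ ω = Measure.sum (fun i => (Ψ i ω).map (fun y => X i ω + y))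

/-- The `k`-th contact distance from the location `u`: the distance from `u` to the `k`-th closest
point of `Φ`, that is the least radius `ρ` such that the closed ball of radius `ρ` about `u` holds
at least `k` points (it is `∞` if there are fewer than `k` points). -/
def contactDistance {n : ℕ} {Ω : Type*} (Φ : Ω → Measure (Space n)) (u : Space n) (k : ℕ)
    (ω : Ω) : ℝ≥0∞ :=
  ⨅ (ρ : ℝ≥0) (_ : (k : ℝ≥0∞) ≤ Φ ω (Metric.closedBall u ρ)), (ρ : ℝ≥0∞)

/-- The cumulative distribution function, at `r ≥ 0`, of the law of the `k`-th contact distance. -/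
def contactCDF {n : ℕ} {Ω : Type*} [MeasurableSpace Ω] (P : Measure Ω)
    (Φ : Ω → Measure (Space n)) (u : Space n) (k : ℕ) (r : ℝ) : ℝ :=
  (P.map (contactDistance Φ u k)).real (Iic (ENNReal.ofReal r))

/-- The volume `v_n` of the unit ball of `ℝⁿ`. -/
def unitBallVolume (n : ℕ) : ℝ :=
  Real.pi ^ ((n : ℝ) / 2) / Real.Gamma ((n : ℝ) / 2 + 1)

/-- The volume `A(r, rd, x)` of the intersection of two balls of `ℝⁿ` of radii `r` and `rd` whose
centres are at distance `x`. -/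
def lensVolume (n : ℕ) [NeZero n] (r rd x : ℝ) : ℝ :=
  (volume : Measure (Space n)).real
    (Metric.closedBall 0 r ∩ Metric.closedBall (EuclideanSpace.single 0 x) rd)

/-- `h_k(r) = (lp n v_n / k!) ∫_0^{r+rd} (ld A(r,rd,x))^k e^{-ld A(r,rd,x)} x^{n-1} dx`. -/
def hCoeff (n : ℕ) [NeZero n] (lp ld rd : ℝ) (k : ℕ) (r : ℝ) : ℝ :=
  lp * n * unitBallVolume n / (k.factorial : ℝ) *
    ∫ x in (0 : ℝ)..(r + rd),
      (ld * lensVolume n r rd x) ^ k * Real.exp (-(ld * lensVolume n r rd x)) * x ^ (n - 1)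

end Matern

end

noncomputable section

namespace Matern

open Filter Topology

/-! Let `N` be the number of points of `Φ` in the closed ball of radius `r` about `u`. The `k`th
contact distance is at most `r` exactly when `N ≥ k` (`IsMaternClusterProcess.contactCDF_eq`), so
only the probabilities of `N = 0, 1, 2` are needed; they are read off from the generating function
`E[s^N]`.

Given the parents, `N` is a sum of independent Poisson variables with means `a(X i)`, where `a(x) =
ld * A(r, rd, ‖x - u‖)`. Hence the conditional generating function is the product of the `exp(-(1 -
s) a(X i))` (`integral_prod_clusters`). Averaging over the parents with the Laplace functional of a
Poisson process (`IsPoissonProcess.laplace`) gives `E[s^N] = exp(-lp ∫ (1 - exp(-(1 - s) a(x)))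
dx)`, and polar coordinates turn the exponent into `logPGF`.

Since `exp(-(1 - s) a) = exp(-a) exp(s a)`, the Taylor coefficients of the exponent at `s = 0` are
the `h_k`, with `-lp v_n (r + rd)^n` added to the constant one (`logPGF_expansion`). Exponentiating
and comparing coefficients modulo `O(s^3)` as `s → 0+` (`coeff_eq_of_isBigO_exp`) gives the three
probabilities, without differentiating under an integral. -/

theorem norm_exp_neg_toReal_le_one (x : ℝ≥0∞) : ‖Real.exp (-x.toReal)‖ ≤ 1 := by
  rw [Real.norm_eq_abs, Real.abs_exp, Real.exp_le_one_iff, neg_nonpos]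
  exact ENNReal.toReal_nonneg

theorem integral_exp_poissonMeasure (a : ℝ≥0) (t : ℝ) :
    ∫ m : ℕ, Real.exp (-(t * m)) ∂(poissonMeasure a) = Real.exp (-(a * (1 - Real.exp (-t)))) := by
  rw [integral_poissonMeasure]
  have h := (NormedSpace.expSeries_div_hasSum_exp ((a : ℝ) * Real.exp (-t))).mul_left
    (Real.exp (-a))
  rw [← Real.exp_eq_exp_ℝ, ← Real.exp_add] at h
  rw [show -(a * (1 - Real.exp (-t))) = -(a : ℝ) + a * Real.exp (-t) by ring, ← h.tsum_eq]
  congr 1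
  ext m
  rw [mul_pow, ← Real.exp_nat_mul, smul_eq_mul, show -(t * (m : ℝ)) = m * -t by ring]
  ring

/-! ### Laplace functional of a Poisson process -/

section PoissonProcess

variable {n : ℕ} {Ω : Type*} [MeasurableSpace Ω] {P : Measure Ω}
  {N : Ω → Measure (Space n)} {Λ : Measure (Space n)}

theorem IsPointProcess.measurable_coe (hN : IsPointProcess P N) {B : Set (Space n)}
    (hB : MeasurableSet B) : Measurable fun ω => N ω B :=
  (Measure.measurable_coe hB).comp hN.measurable

theorem IsPoissonProcess.integral_comp_coe (hN : IsPoissonProcess P N Λ) {B : Set (Space n)}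
    (hB : MeasurableSet B) (hΛ : Λ B < ∞) {φ : ℝ≥0∞ → ℝ} (hφ : Measurable φ) :
    ∫ ω, φ (N ω B) ∂P = ∫ m : ℕ, φ m ∂(poissonMeasure (Λ B).toNNReal) := by
  rw [← integral_map (φ := fun ω => N ω B) (hN.measurable_coe hB).aemeasurable
    hφ.aestronglyMeasurable, hN.law B hB hΛ,
    integral_map (by fun_prop) hφ.aestronglyMeasurable]

/-- The building block for simple functions. The value `c = ∞` is harmless: `toReal` is
multiplicative and sends it to `0`, so both sides are those of `c = 0`. -/
theorem IsPoissonProcess.integral_exp_mul (hN : IsPoissonProcess P N Λ) {B : Set (Space n)}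
    (hB : MeasurableSet B) (hΛ : Λ B < ∞) (c : ℝ≥0∞) :
    ∫ ω, Real.exp (-(c * N ω B).toReal) ∂P
      = Real.exp (-(Λ.real B * (1 - Real.exp (-c.toReal)))) := by
  rw [hN.integral_comp_coe hB hΛ (φ := fun x => Real.exp (-(c * x).toReal)) (by fun_prop)]
  simp only [ENNReal.toReal_mul, ENNReal.toReal_natCast]
  rw [integral_exp_poissonMeasure]
  rfl

theorem IsPoissonProcess.iIndepFun_coe {ι : Type*} [Finite ι] (hN : IsPoissonProcess P N Λ)
    {B : ι → Set (Space n)} (hB : ∀ i, MeasurableSet (B i))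
    (hd : Pairwise (Function.onFun Disjoint B)) : iIndepFun (fun i ω => N ω (B i)) P := by
  obtain ⟨m, ⟨e⟩⟩ := Finite.exists_equiv_fin ι
  have h := hN.indep m (fun i => B (e.symm i)) (fun i => hB _)
    (fun i j hij => hd (e.symm.injective.ne hij))
  have := h.precomp e.injective
  simpa [Function.comp_def] using this

/-- A point process is almost surely finite on a given bounded Borel set. -/
theorem IsPointProcess.ae_lt_top (hN : IsPointProcess P N) :
    ∀ᵐ ω ∂P, ∀ B : Set (Space n), Bornology.IsBounded B → N ω B < ∞ := by
  filter_upwards [hN.counting] with ω h B hb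
  obtain ⟨R, hR⟩ := hb.subset_closedBall 0
  obtain ⟨m, hm⟩ := h (Metric.closedBall 0 R) measurableSet_closedBall Metric.isBounded_closedBall
  exact (measure_mono hR).trans_lt (hm ▸ ENNReal.natCast_lt_top m)

/-- The Laplace functional of a Poisson process at a simple function. -/
theorem IsPoissonProcess.laplace_simpleFunc (hN : IsPoissonProcess P N Λ) {K : Set (Space n)}
    (hKb : Bornology.IsBounded K) (hΛ : Λ K < ∞) (g : SimpleFunc (Space n) ℝ≥0∞)
    (hg : ∀ x, g x < ∞) (hgK : ∀ x, x ∉ K → g x = 0) :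
    ∫ ω, Real.exp (-(∫⁻ x, g x ∂(N ω)).toReal) ∂P
      = Real.exp (-∫ x, (1 - Real.exp (-(g x).toReal)) ∂Λ) := by
  classical
  -- The value `0` is discarded because its fibre may be unbounded; the other fibres lie in `K`,
  -- where intensity and counts are finite.
  set s : Finset ℝ≥0∞ := g.range.filter (· ≠ 0) with hs
  have hsub : ∀ c ∈ s, g ⁻¹' {c} ⊆ K := by
    intro c hc x hx
    by_contra hxK
    exact (Finset.mem_filter.1 hc).2 (hx.symm.trans (hgK x hxK))
  have hmeas : ∀ c, MeasurableSet (g ⁻¹' {c}) := fun c => g.measurableSet_fiber c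
  have htop : ∀ c ∈ s, c < ∞ := by
    intro c hc
    obtain ⟨x, rfl⟩ := SimpleFunc.mem_range.1 (Finset.mem_filter.1 hc).1
    exact hg x
  have hint : ∀ ν : Measure (Space n), ∫⁻ x, g x ∂ν = ∑ c ∈ s, c * ν (g ⁻¹' {c}) := by
    intro ν
    rw [g.lintegral_eq_lintegral, SimpleFunc.lintegral, hs, Finset.sum_filter]
    refine Finset.sum_congr rfl fun c _ => ?_
    split_ifs with h
    · rfl
    · simp [not_not.1 h]
  have hL : ∀ᵐ ω ∂P, Real.exp (-(∫⁻ x, g x ∂(N ω)).toReal)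
      = ∏ c : s, Real.exp (-((c : ℝ≥0∞) * N ω (g ⁻¹' {(c : ℝ≥0∞)})).toReal) := by
    filter_upwards [hN.ae_lt_top] with ω hω
    rw [hint, ENNReal.toReal_sum, ← Real.exp_sum, Finset.sum_neg_distrib,
      Finset.sum_coe_sort s (fun c => (c * N ω (g ⁻¹' {c})).toReal)]
    exact fun c hc => ENNReal.mul_ne_top (htop c hc).ne (hω _ (hKb.subset (hsub c hc))).ne
  have hR : ∫ x, (1 - Real.exp (-(g x).toReal)) ∂Λ
      = ∑ c ∈ s, Λ.real (g ⁻¹' {c}) * (1 - Real.exp (-c.toReal)) := by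
    have : ∀ x, 1 - Real.exp (-(g x).toReal)
        = ∑ c ∈ s, (g ⁻¹' {c}).indicator (fun _ => 1 - Real.exp (-c.toReal)) x := by
      intro x
      by_cases hx : g x = 0
      · rw [Finset.sum_eq_zero]
        · simp [hx]
        · intro c hc
          refine indicator_of_notMem ?_ _
          rintro rfl
          exact (Finset.mem_filter.1 hc).2 hx
      · rw [Finset.sum_eq_single (g x)]
        · simp
        · intro c _ hcx
          exact indicator_of_notMem (fun h => hcx h.symm) _
        · intro h
          exact absurd (Finset.mem_filter.2 ⟨g.mem_range_self x, hx⟩) h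
    simp_rw [this]
    rw [integral_finsetSum]
    · refine Finset.sum_congr rfl fun c _ => ?_
      rw [integral_indicator_const _ (hmeas c), smul_eq_mul]
    · intro c hc
      exact (integrable_indicator_iff (hmeas c)).2
        (integrableOn_const ((measure_mono (hsub c hc)).trans_lt hΛ).ne)
  rw [integral_congr_ae hL, hR, ← Finset.sum_neg_distrib, Real.exp_sum, ← Finset.prod_coe_sort]
  have hind : iIndepFun (fun (c : s) ω => N ω (g ⁻¹' {(c : ℝ≥0∞)})) P :=
    hN.iIndepFun_coe (fun c => hmeas c) fun c d hcd => by
      refine Disjoint.preimage _ ?_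
      simpa using fun h => hcd (Subtype.ext h)
  rw [hind.integral_fun_prod_comp (f := fun (c : s) x => Real.exp (-((c : ℝ≥0∞) * x).toReal))
    (fun c => (hN.measurable_coe (hmeas c)).aemeasurable)
    (fun c => Measurable.aestronglyMeasurable (by fun_prop))]
  exact Finset.prod_congr rfl fun c _ =>
    hN.integral_exp_mul (hmeas c) ((measure_mono (hsub c c.2)).trans_lt hΛ) c

/-- The Laplace functional of a Poisson process. -/
theorem IsPoissonProcess.laplace [IsProbabilityMeasure P] (hN : IsPoissonProcess P N Λ)
    {K : Set (Space n)} (hK : MeasurableSet K)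
    (hKb : Bornology.IsBounded K) (hΛ : Λ K < ∞) {f : Space n → ℝ≥0∞} (hf : Measurable f)
    {C : ℝ≥0∞} (hC : C ≠ ∞) (hfC : ∀ x, f x ≤ C) (hfK : ∀ x, x ∉ K → f x = 0) :
    ∫ ω, Real.exp (-(∫⁻ x, f x ∂(N ω)).toReal) ∂P
      = Real.exp (-∫ x, (1 - Real.exp (-(f x).toReal)) ∂Λ) := by
  set g := SimpleFunc.eapprox f
  have hle : ∀ m x, g m x ≤ f x := fun m x => by
    rw [← SimpleFunc.iSup_eapprox_apply hf x]
    exact le_iSup (fun k => g k x) m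
  have hgK : ∀ m x, x ∉ K → g m x = 0 := fun m x hx =>
    le_antisymm ((hle m x).trans (hfK x hx).le) zero_le
  have hgt : ∀ m x, g m x < ∞ := fun m x => ((hle m x).trans (hfC x)).trans_lt hC.lt_top
  have hlim : ∀ x, Tendsto (fun m => g m x) atTop (𝓝 (f x)) := fun x => by
    rw [← SimpleFunc.iSup_eapprox_apply hf x]
    exact tendsto_atTop_iSup fun i j hij => SimpleFunc.monotone_eapprox f hij x
  have h1 : Tendsto (fun m => ∫ ω, Real.exp (-(∫⁻ x, g m x ∂(N ω)).toReal) ∂P) atTop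
      (𝓝 (∫ ω, Real.exp (-(∫⁻ x, f x ∂(N ω)).toReal) ∂P)) := by
    refine tendsto_integral_of_dominated_convergence (fun _ => 1) (fun m => ?_)
      (integrable_const 1) (fun m => ?_) ?_
    · exact ((Measure.measurable_lintegral (g m).measurable).comp
        hN.measurable).ennreal_toReal.neg.exp.aestronglyMeasurable
    · refine ae_of_all _ fun ω => ?_
      exact norm_exp_neg_toReal_le_one _
    -- `toReal` is continuous only away from `∞`; the limit integral is at most `C * N ω K`, which
    -- is almost surely finite.
    · filter_upwards [hN.ae_lt_top] with ω hω
      refine (Real.continuous_exp.tendsto _).comp (Tendsto.neg ?_)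
      refine (ENNReal.tendsto_toReal ?_).comp ?_
      · refine (lt_of_le_of_lt ?_ (ENNReal.mul_lt_top hC.lt_top (hω K hKb))).ne
        rw [← lintegral_indicator_const hK]
        refine lintegral_mono fun x => ?_
        by_cases hx : x ∈ K
        · simpa [hx] using hfC x
        · simp [hx, hfK x hx]
      · exact lintegral_tendsto_of_tendsto_of_monotone (fun m => (g m).measurable.aemeasurable)
          (ae_of_all _ fun x i j hij => SimpleFunc.monotone_eapprox f hij x)
          (ae_of_all _ hlim)
  have h2 : Tendsto (fun m => Real.exp (-∫ x, (1 - Real.exp (-(g m x).toReal)) ∂Λ)) atTop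
      (𝓝 (Real.exp (-∫ x, (1 - Real.exp (-(f x).toReal)) ∂Λ))) := by
    refine (Real.continuous_exp.tendsto _).comp (Tendsto.neg ?_)
    -- `Λ` may be infinite, so the constant `1` need not be integrable; its restriction to `K` still
    -- dominates.
    refine tendsto_integral_of_dominated_convergence (K.indicator fun _ => 1) (fun m => ?_)
      ((integrable_indicator_iff hK).2 (integrableOn_const hΛ.ne)) (fun m => ?_) ?_
    · exact (measurable_const.sub
        (g m).measurable.ennreal_toReal.neg.exp).aestronglyMeasurable
    · refine ae_of_all _ fun x => ?_
      by_cases hx : x ∈ K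
      · have : Real.exp (-(g m x).toReal) ≤ 1 := by
          rw [Real.exp_le_one_iff]; simp
        rw [indicator_of_mem hx, Real.norm_eq_abs, abs_of_nonneg (by linarith)]
        linarith [Real.exp_pos (-(g m x).toReal)]
      · simp [hx, hgK m x hx]
    · refine ae_of_all _ fun x => tendsto_const_nhds.sub ?_
      refine (Real.continuous_exp.tendsto _).comp (Tendsto.neg ?_)
      exact (ENNReal.tendsto_toReal ((hfC x).trans_lt hC.lt_top).ne).comp (hlim x)
  refine tendsto_nhds_unique h1 (h2.congr fun m => ?_)
  exact (hN.laplace_simpleFunc hKb hΛ (g m) (hgt m) (hgK m)).symm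

end PoissonProcess

/-! ### Poisson counts on sets of finite or zero intensity -/

section PoissonProcess

variable {n : ℕ} {Ω : Type*} [MeasurableSpace Ω] {P : Measure Ω}
  {N : Ω → Measure (Space n)} {Λ : Measure (Space n)}

theorem IsPoissonProcess.ae_lt_top_of_lt_top (hN : IsPoissonProcess P N Λ) {B : Set (Space n)}
    (hB : MeasurableSet B) (hΛ : Λ B < ∞) : ∀ᵐ ω ∂P, N ω B < ∞ := by
  refine ae_of_ae_map (hN.measurable_coe hB).aemeasurable (p := fun x => x < ∞) ?_
  rw [hN.law B hB hΛ, ae_map_iff (by fun_prop) measurableSet_Iio]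
  exact ae_of_all _ fun m => ENNReal.natCast_lt_top m

theorem IsPoissonProcess.ae_eq_zero (hN : IsPoissonProcess P N Λ) {B : Set (Space n)}
    (hB : MeasurableSet B) (hΛ : Λ B = 0) : ∀ᵐ ω ∂P, N ω B = 0 := by
  refine ae_of_ae_map (hN.measurable_coe hB).aemeasurable (p := fun x => x = 0) ?_
  rw [hN.law B hB (hΛ ▸ ENNReal.zero_lt_top), ae_map_iff (by fun_prop)
    measurableSet_eq, hΛ]
  have h : poissonMeasure (0 : ℝ≥0∞).toNNReal {0} = 1 := by
    simp [poissonMeasure_singleton]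
  have h' := (prob_compl_eq_zero_iff (measurableSet_singleton 0)).2 h
  filter_upwards [compl_mem_ae_iff.2 h'] with m hm
  simpa using hm

end PoissonProcess

/-! ### Translates of random measures and the range of a cluster -/

section Translate

variable {n : ℕ}

/-- The normalisation of a measure, as a finite kernel. -/
def normalizeKernel (n : ℕ) : Kernel (Space n × Measure (Space n)) (Space n) where
  toFun p := (p.2 univ)⁻¹ • p.2
  measurable' := by
    refine Measure.measurable_of_measurable_coe _ fun s hs => ?_
    simp only [Measure.smul_apply, smul_eq_mul]
    exact ((Measure.measurable_coe MeasurableSet.univ).comp measurable_snd).inv.mul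
      ((Measure.measurable_coe hs).comp measurable_snd)

instance : IsFiniteKernel (normalizeKernel n) :=
  ⟨1, ENNReal.one_lt_top, fun p => by
    change ((p.2 univ)⁻¹ • p.2) univ ≤ 1
    rw [Measure.smul_apply, smul_eq_mul]
    exact ENNReal.inv_mul_le_one _⟩

/-- The mass that the translate by `p.1` of the measure `p.2` gives to `B`, if `p.2` is finite. -/
def translateMass (B : Set (Space n)) (p : Space n × Measure (Space n)) : ℝ≥0∞ :=
  p.2 univ * normalizeKernel n p ((fun y => p.1 + y) ⁻¹' B)

/-- Joint measurability in the shift and the measure is measurability of sections for a finite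
kernel. Dividing by the total mass makes the kernel finite; multiplying it back restores the mass
whenever the measure is finite. -/
theorem measurable_translateMass {B : Set (Space n)} (hB : MeasurableSet B) :
    Measurable (translateMass B) := by
  refine ((Measure.measurable_coe MeasurableSet.univ).comp measurable_snd).mul ?_
  have hs : MeasurableSet
      ((fun q : (Space n × Measure (Space n)) × Space n => q.1.1 + q.2) ⁻¹' B) :=
    ((measurable_fst.comp measurable_fst).add measurable_snd) hB
  exact Kernel.measurable_kernel_prodMk_left hs

theorem translateMass_eq {B : Set (Space n)} {x : Space n} {μ : Measure (Space n)}
    (hμ : μ univ < ∞) : translateMass B (x, μ) = μ ((fun y => x + y) ⁻¹' B) := by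
  change μ univ * ((μ univ)⁻¹ • μ) _ = _
  rw [Measure.smul_apply, smul_eq_mul, ← mul_assoc]
  by_cases h0 : μ univ = 0
  · have : μ ((fun y => x + y) ⁻¹' B) = 0 := measure_mono_null (subset_univ _) h0
    simp [this]
  · rw [ENNReal.mul_inv_cancel h0 hμ.ne, one_mul]

theorem isBounded_preimage_add_left {B : Set (Space n)} (hB : Bornology.IsBounded B)
    (x : Space n) : Bornology.IsBounded ((fun y => x + y) ⁻¹' B) :=
  (isometry_add_left x).antilipschitz.isBounded_preimage hB

/-- The intensity of the daughter process. -/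
def daughterIntensity (n : ℕ) (ld rd : ℝ) : Measure (Space n) :=
  ENNReal.ofReal ld • volume.restrict (Metric.closedBall 0 rd)

instance (ld rd : ℝ) : IsFiniteMeasure (daughterIntensity n ld rd) := by
  have : IsFiniteMeasure ((volume : Measure (Space n)).restrict (Metric.closedBall 0 rd)) :=
    ⟨by simpa using measure_closedBall_lt_top⟩
  exact Measure.smul_finite _ ENNReal.ofReal_ne_top

theorem daughterIntensity_compl (ld rd : ℝ) :
    daughterIntensity n ld rd (Metric.closedBall 0 rd)ᶜ = 0 := by
  simp [daughterIntensity, Measure.restrict_apply measurableSet_closedBall.compl]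

theorem notMem_preimage_add_left {x y u : Space n} {r rd : ℝ}
    (hx : x ∉ Metric.closedBall u (r + rd)) (hy : y ∈ Metric.closedBall 0 rd) :
    y ∉ (fun y => x + y) ⁻¹' Metric.closedBall u r := by
  intro h
  apply hx
  rw [mem_preimage, mem_closedBall_iff_norm] at h
  rw [mem_closedBall_zero_iff] at hy
  rw [mem_closedBall_iff_norm]
  calc ‖x - u‖ = ‖(x + y - u) - y‖ := by congr 1; abel
    _ ≤ ‖x + y - u‖ + ‖y‖ := norm_sub_le _ _
    _ ≤ r + rd := add_le_add h hy

theorem measure_preimage_add_left_eq_zero {μ : Measure (Space n)} {x u : Space n} {r rd : ℝ}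
    (hμ : μ (Metric.closedBall 0 rd)ᶜ = 0) (hx : x ∉ Metric.closedBall u (r + rd)) :
    μ ((fun y => x + y) ⁻¹' Metric.closedBall u r) = 0 :=
  measure_mono_null (fun _ hy hy' => notMem_preimage_add_left hx hy' hy) hμ

end Translate

/-! ### Conditioning on the parents -/

section Cluster

variable {n : ℕ} {Ω : Type*} [MeasurableSpace Ω] {P : Measure Ω}
  {X : ℕ → Ω → Space n} {Ψ : ℕ → Ω → Measure (Space n)} {Λ : Measure (Space n)} {ld rd : ℝ}

theorem ae_forall_daughter
    (hΨ : ∀ i, IsPoissonProcess P (Ψ i) (daughterIntensity n ld rd)) :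
    ∀ᵐ ω ∂P, ∀ i, Ψ i ω univ < ∞ ∧ Ψ i ω (Metric.closedBall 0 rd)ᶜ = 0 := by
  rw [ae_all_iff]
  intro i
  filter_upwards [(hΨ i).ae_lt_top_of_lt_top MeasurableSet.univ (measure_lt_top _ _),
    (hΨ i).ae_eq_zero measurableSet_closedBall.compl (daughterIntensity_compl ld rd)] with ω h h'
  exact ⟨h, h'⟩

/-- Almost surely every bounded set contains finitely many parents. -/
theorem ae_finite_parents
    (hX : IsPoissonProcess P (fun ω => Measure.sum (fun i => Measure.dirac (X i ω))) Λ) :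
    ∀ᵐ ω ∂P, ∀ R : ℝ, ∀ u, {i | X i ω ∈ Metric.closedBall u R}.Finite := by
  filter_upwards [hX.ae_lt_top] with ω hω R u
  have h := hω _ (Metric.isBounded_closedBall (x := u) (r := R))
  rw [Measure.sum_apply _ measurableSet_closedBall] at h
  -- Each parent in the ball contributes a term equal to `1`, and a finite sum admits only finitely
  -- many of these.
  refine (ENNReal.finite_const_le_of_tsum_ne_top h.ne one_ne_zero).subset fun i hi => ?_
  have hi' : X i ω ∈ Metric.closedBall u R := hi
  simp [Measure.dirac_apply' _ (measurableSet_closedBall (x := u) (ε := R)), hi']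

/-- A Matérn cluster process is almost surely a locally finite counting measure. -/
theorem IsMaternClusterProcess.counting {lp : ℝ} {Φ : Ω → Measure (Space n)}
    (hΦ : IsMaternClusterProcess P lp ld rd Φ) :
    ∀ᵐ ω ∂P, ∀ (u : Space n) (r : ℝ), ∃ m : ℕ, Φ ω (Metric.closedBall u r) = m := by
  obtain ⟨X, Ψ, -, hX, hΨ, -, -, hsum⟩ := hΦ
  filter_upwards [hsum, ae_forall_daughter hΨ, ae_finite_parents hX,
    ae_all_iff.2 fun i => (hΨ i).counting] with ω hω hd hp hc u r
  rw [hω, Measure.sum_apply _ measurableSet_closedBall]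
  have hmap : ∀ i, (Ψ i ω).map (fun y => X i ω + y) (Metric.closedBall u r)
      = Ψ i ω ((fun y => X i ω + y) ⁻¹' Metric.closedBall u r) := fun i =>
    Measure.map_apply (by fun_prop) measurableSet_closedBall
  have hnat : ∀ i, ∃ m : ℕ,
      Ψ i ω ((fun y => X i ω + y) ⁻¹' Metric.closedBall u r) = m := fun i =>
    hc i _ ((measurable_const_add _) measurableSet_closedBall)
      (isBounded_preimage_add_left Metric.isBounded_closedBall _)
  choose m hm using hnat
  -- Daughters lie within `rd` of their parent, so only parents within `r + rd` of `u` contribute.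
  refine ⟨∑ i ∈ (hp (r + rd) u).toFinset, m i, ?_⟩
  rw [tsum_eq_sum (s := (hp (r + rd) u).toFinset)]
  · push_cast
    exact Finset.sum_congr rfl fun i _ => (hmap i).trans (hm i)
  · intro i hi
    rw [hmap]
    exact measure_preimage_add_left_eq_zero (hd i).2 (by simpa using hi)

theorem ae_apply_eq_tsum {Φ : Ω → Measure (Space n)}
    (hΨ : ∀ i, IsPoissonProcess P (Ψ i) (daughterIntensity n ld rd))
    (hsum : ∀ᵐ ω ∂P, Φ ω = Measure.sum (fun i => (Ψ i ω).map (fun y => X i ω + y)))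
    {B : Set (Space n)} (hB : MeasurableSet B) :
    ∀ᵐ ω ∂P, Φ ω B = ∑' i, translateMass B (X i ω, Ψ i ω) := by
  filter_upwards [hsum, ae_forall_daughter hΨ] with ω hω hd
  rw [hω, Measure.sum_apply _ hB]
  refine tsum_congr fun i => ?_
  rw [Measure.map_apply (by fun_prop) hB, translateMass_eq (hd i).1]

theorem IsMaternClusterProcess.aemeasurable {lp : ℝ} {Φ : Ω → Measure (Space n)}
    (hΦ : IsMaternClusterProcess P lp ld rd Φ) {B : Set (Space n)} (hB : MeasurableSet B) :
    AEMeasurable (fun ω => Φ ω B) P := by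
  obtain ⟨X, Ψ, hXm, hX, hΨ, -, -, hsum⟩ := hΦ
  exact ⟨_, Measurable.tsum fun i => (measurable_translateMass hB).comp
    ((hXm i).prodMk (hΨ i).measurable), ae_apply_eq_tsum hΨ hsum hB⟩

/-- Conditioning on the parents: the Laplace transform of the number of points in `B` of the first
`m` clusters. -/
theorem integral_prod_clusters [IsProbabilityMeasure P] (hXm : ∀ i, Measurable (X i))
    (hΨ : ∀ i, IsPoissonProcess P (Ψ i) (daughterIntensity n ld rd))
    (hΨi : iIndepFun Ψ P) (hXΨ : IndepFun (fun ω i => X i ω) (fun ω i => Ψ i ω) P)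
    {B : Set (Space n)} (hB : MeasurableSet B) (c : ℝ≥0∞) (m : ℕ) :
    ∫ ω, ∏ i : Fin m, Real.exp (-(c * translateMass B (X i ω, Ψ i ω)).toReal) ∂P
      = ∫ ω, ∏ i : Fin m, Real.exp (-((daughterIntensity n ld rd).real
          ((fun y => X i ω + y) ⁻¹' B) * (1 - Real.exp (-c.toReal)))) ∂P := by
  have hXm' : Measurable fun ω i => X i ω := measurable_pi_lambda _ hXm
  have hΨm' : Measurable fun ω i => Ψ i ω := measurable_pi_lambda _ fun i => (hΨ i).measurable
  set G : (ℕ → Space n) × (ℕ → Measure (Space n)) → ℝ := fun p =>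
    ∏ i : Fin m, Real.exp (-(c * translateMass B (p.1 i, p.2 i)).toReal) with hG
  have hGm : Measurable G := by
    refine Finset.measurable_fun_prod _ fun i _ => ?_
    refine ((Measurable.const_mul ?_ c).ennreal_toReal).neg.exp
    exact (measurable_translateMass hB).comp
      (((measurable_pi_apply _).comp measurable_fst).prodMk
        ((measurable_pi_apply _).comp measurable_snd))
  have hG1 : ∀ p, ‖G p‖ ≤ 1 := by
    intro p
    rw [hG, norm_prod]
    refine Finset.prod_le_one (fun _ _ => norm_nonneg _) fun i _ => ?_
    exact norm_exp_neg_toReal_le_one _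
  have hP1 := Measure.isProbabilityMeasure_map (μ := P) hXm'.aemeasurable
  have hP2 := Measure.isProbabilityMeasure_map (μ := P) hΨm'.aemeasurable
  calc _ = ∫ p, G p ∂(P.map fun ω => (fun i => X i ω, fun i => Ψ i ω)) :=
        (integral_map (hXm'.prodMk hΨm').aemeasurable hGm.aestronglyMeasurable).symm
    _ = ∫ x, ∫ ψ, G (x, ψ) ∂(P.map fun ω i => Ψ i ω) ∂(P.map fun ω i => X i ω) := by
        -- Independence of parents and daughters makes the joint law a product; Fubini then allows
        -- the parents to be frozen.
        rw [(indepFun_iff_map_prod_eq_prod_map_map hXm'.aemeasurable hΨm'.aemeasurable).1 hXΨ]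
        exact integral_prod _ (Integrable.of_bound hGm.aestronglyMeasurable 1 (ae_of_all _ hG1))
    _ = ∫ ω, ∫ ψ, G (fun i => X i ω, ψ) ∂(P.map fun ω i => Ψ i ω) ∂P :=
        integral_map hXm'.aemeasurable
          (hGm.stronglyMeasurable.integral_prod_right').aestronglyMeasurable
    _ = _ := by
        refine integral_congr_ae (ae_of_all _ fun ω' => ?_)
        dsimp only
        rw [integral_map (f := fun ψ => G (fun i => X i ω', ψ)) hΨm'.aemeasurable
          (hGm.comp measurable_prodMk_left).aestronglyMeasurable]
        simp only [hG]
        have hind := hΨi.precomp (g := fun i : Fin m => (i : ℕ)) Fin.val_injective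
        rw [hind.integral_fun_prod_comp
          (f := fun (i : Fin m) μ => Real.exp (-(c * translateMass B (X i ω', μ)).toReal))
          (fun i => (hΨ i).measurable.aemeasurable)
          (fun i => (((measurable_translateMass hB).comp
            measurable_prodMk_left).const_mul c).ennreal_toReal.neg.exp.aestronglyMeasurable)]
        refine Finset.prod_congr rfl fun i _ => ?_
        rw [← (hΨ i).integral_exp_mul ((measurable_const_add _) hB) (measure_lt_top _ _) c]
        refine integral_congr_ae ?_
        filter_upwards [ae_forall_daughter hΨ] with ω hω
        rw [translateMass_eq (hω i).1]

/-- The Laplace transform of the number of points of a Matérn cluster process in a ball. -/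
theorem IsMaternClusterProcess.laplace [IsProbabilityMeasure P] {lp : ℝ}
    {Φ : Ω → Measure (Space n)}
    (hΦ : IsMaternClusterProcess P lp ld rd Φ) (u : Space n) (r : ℝ) {c : ℝ≥0∞} (hc : c ≠ ∞) :
    ∫ ω, Real.exp (-(c * Φ ω (Metric.closedBall u r)).toReal) ∂P
      = Real.exp (-∫ x, (1 - Real.exp (-((daughterIntensity n ld rd).real
          ((fun y => x + y) ⁻¹' Metric.closedBall u r) * (1 - Real.exp (-c.toReal)))))
            ∂(ENNReal.ofReal lp • volume : Measure (Space n))) := by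
  have hcount := hΦ.counting
  obtain ⟨X, Ψ, hXm, hX, hΨ, hΨi, hXΨ, hsum⟩ := hΦ
  set B := Metric.closedBall u r with hBdef
  have hB : MeasurableSet B := measurableSet_closedBall
  set Λ := daughterIntensity n ld rd
  have hs : 0 ≤ 1 - Real.exp (-c.toReal) := by
    rw [sub_nonneg, Real.exp_le_one_iff]; simp
  -- `exp(-f x)` is the Laplace transform at `c` of the count in `B` from one cluster with parent
  -- `x`.
  set f : Space n → ℝ≥0∞ := fun x =>
    Λ ((fun y => x + y) ⁻¹' B) * ENNReal.ofReal (1 - Real.exp (-c.toReal)) with hf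
  have hfm : Measurable f := by
    refine Measurable.mul_const ?_ _
    have : MeasurableSet ((fun q : Space n × Space n => q.1 + q.2) ⁻¹' B) := measurable_add hB
    exact measurable_measure_prodMk_left this
  have hfr : ∀ x, (f x).toReal
      = Λ.real ((fun y => x + y) ⁻¹' B) * (1 - Real.exp (-c.toReal)) := fun x => by
    rw [hf, ENNReal.toReal_mul, ENNReal.toReal_ofReal hs]; rfl
  set C := Λ univ * ENNReal.ofReal (1 - Real.exp (-c.toReal))
  have hC : C ≠ ∞ := ENNReal.mul_ne_top (measure_ne_top _ _) ENNReal.ofReal_ne_top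
  have hfC : ∀ x, f x ≤ C := fun x => mul_le_mul_left (measure_mono (subset_univ _)) _
  have hfK : ∀ x, x ∉ Metric.closedBall u (r + rd) → f x = 0 := fun x hx => by
    rw [hf]; dsimp only
    rw [measure_preimage_add_left_eq_zero (daughterIntensity_compl ld rd) hx, zero_mul]
  have hlap := hX.laplace measurableSet_closedBall Metric.isBounded_closedBall
    (by
      rw [Measure.smul_apply, smul_eq_mul]
      exact ENNReal.mul_lt_top ENNReal.ofReal_lt_top measure_closedBall_lt_top) hfm hC hfC hfK
  simp only [hfr] at hlap
  rw [← hlap]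
  -- The identity for the first `m` clusters passes to the limit on both sides by dominated
  -- convergence; all products are bounded by `1`.
  have h1 : Tendsto (fun m => ∫ ω, ∏ i : Fin m,
      Real.exp (-(c * translateMass B (X i ω, Ψ i ω)).toReal) ∂P) atTop
      (𝓝 (∫ ω, Real.exp (-(c * Φ ω B).toReal) ∂P)) := by
    refine tendsto_integral_of_dominated_convergence (fun _ => 1) (fun m => ?_)
      (integrable_const 1) (fun m => ?_) ?_
    · refine (Finset.measurable_fun_prod _ fun i _ => ?_).aestronglyMeasurable
      exact (((measurable_translateMass hB).comp
        ((hXm i).prodMk (hΨ i).measurable)).const_mul c).ennreal_toReal.neg.exp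
    · refine ae_of_all _ fun ω => ?_
      rw [norm_prod]
      refine Finset.prod_le_one (fun _ _ => norm_nonneg _) fun i _ => ?_
      exact norm_exp_neg_toReal_le_one _
    · filter_upwards [hcount, ae_apply_eq_tsum hΨ hsum hB] with ω hω hω'
      obtain ⟨k, hk⟩ := hω u r
      have hk' : Φ ω B ≠ ∞ := hk ▸ ENNReal.natCast_ne_top k
      have hfin : ∀ i, translateMass B (X i ω, Ψ i ω) ≠ ∞ :=
        fun i => ENNReal.ne_top_of_tsum_ne_top (hω' ▸ hk') i
      have hT : Tendsto (fun m => c * ∑ i ∈ Finset.range m, translateMass B (X i ω, Ψ i ω)) atTop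
          (𝓝 (c * Φ ω B)) := by
        rw [hω']
        exact ENNReal.Tendsto.const_mul ENNReal.summable.hasSum.tendsto_sum_nat (Or.inr hc)
      refine (((Real.continuous_exp.tendsto _).comp ((ENNReal.tendsto_toReal
        (ENNReal.mul_ne_top hc hk')).comp hT).neg)).congr fun m => ?_
      rw [← Finset.prod_range
        (fun i => Real.exp (-(c * translateMass B (X i ω, Ψ i ω)).toReal)), ← Real.exp_sum,
        Finset.sum_neg_distrib, ← ENNReal.toReal_sum
          fun i _ => ENNReal.mul_ne_top hc (hfin i), ← Finset.mul_sum]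
      rfl
  have h2 : Tendsto (fun m => ∫ ω, ∏ i : Fin m,
      Real.exp (-(Λ.real ((fun y => X i ω + y) ⁻¹' B) * (1 - Real.exp (-c.toReal)))) ∂P) atTop
      (𝓝 (∫ ω, Real.exp
        (-(∫⁻ x, f x ∂(Measure.sum (fun i => Measure.dirac (X i ω)))).toReal) ∂P)) := by
    simp only [← hfr]
    refine tendsto_integral_of_dominated_convergence (fun _ => 1) (fun m => ?_)
      (integrable_const 1) (fun m => ?_) ?_
    · refine (Finset.measurable_fun_prod _ fun i _ => ?_).aestronglyMeasurable
      exact (hfm.comp (hXm i)).ennreal_toReal.neg.exp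
    · refine ae_of_all _ fun ω => ?_
      rw [norm_prod]
      refine Finset.prod_le_one (fun _ _ => norm_nonneg _) fun i _ => ?_
      exact norm_exp_neg_toReal_le_one _
    · filter_upwards [ae_finite_parents hX] with ω hω
      have hff : ∀ i, f (X i ω) ≠ ∞ := fun i => ((hfC _).trans_lt hC.lt_top).ne
      rw [lintegral_sum_measure]
      simp only [lintegral_dirac' _ hfm]
      have hfin : ∑' i, f (X i ω) ≠ ∞ := by
        rw [tsum_eq_sum (s := (hω (r + rd) u).toFinset) fun i hi => hfK _ (by simpa using hi)]
        exact ENNReal.sum_ne_top.2 fun i _ => hff i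
      refine (((Real.continuous_exp.tendsto _).comp ((ENNReal.tendsto_toReal
        hfin).comp ENNReal.summable.hasSum.tendsto_sum_nat).neg)).congr fun m => ?_
      rw [← Finset.prod_range (fun i => Real.exp (-(f (X i ω)).toReal)), ← Real.exp_sum,
        Finset.sum_neg_distrib, ← ENNReal.toReal_sum fun i _ => hff i]
      rfl
  exact tendsto_nhds_unique h1
    (h2.congr fun m => (integral_prod_clusters hXm hΨ hΨi hXΨ hB c m).symm)

end Cluster

/-! ### Comparison of second-order expansions at `0+` -/

section Taylor

/-- Let `s → 0+` to kill the constant term, divide by `s`, and repeat. The neighbourhood is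
one-sided because the generating function is only available for `0 < s < 1`. -/
theorem eq_zero_of_isBigO_quadratic {a b c : ℝ}
    (h : (fun s : ℝ => a + b * s + c * s ^ 2) =O[𝓝[>] 0] fun s => s ^ 3) :
    a = 0 ∧ b = 0 ∧ c = 0 := by
  have hid : Tendsto (fun s : ℝ => s) (𝓝[>] 0) (𝓝 0) := tendsto_id.mono_left nhdsWithin_le_nhds
  have hdiv : ∀ {f : ℝ → ℝ} {k : ℕ}, (fun s : ℝ => s * f s) =O[𝓝[>] 0] (fun s => s ^ (k + 1)) →
      f =O[𝓝[>] 0] fun s => s ^ k := by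
    intro f k hf
    have := (Asymptotics.isBigO_refl (fun s : ℝ => s⁻¹) (𝓝[>] 0)).mul hf
    refine this.congr' ?_ ?_ <;> filter_upwards [self_mem_nhdsWithin] with s (hs : 0 < s)
    · field_simp
    · rw [pow_succ', inv_mul_cancel_left₀ hs.ne']
  have hlim : ∀ {f : ℝ → ℝ} {k : ℕ} {x : ℝ}, f =O[𝓝[>] 0] (fun s => s ^ (k + 1)) →
      Tendsto f (𝓝[>] 0) (𝓝 x) → x = 0 := by
    intro f k x hf hx
    refine tendsto_nhds_unique hx (hf.trans_tendsto ?_)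
    simpa using hid.pow (k + 1)
  have ha : a = 0 := hlim h (by
    simpa using (tendsto_const_nhds (x := a)).add (hid.const_mul b) |>.add
      ((hid.pow 2).const_mul c))
  subst ha
  have h1 : (fun s : ℝ => b + c * s) =O[𝓝[>] 0] fun s => s ^ 2 :=
    hdiv (h.congr_left fun s => by ring)
  have hb : b = 0 := hlim h1 (by
    simpa using (tendsto_const_nhds (x := b)).add (hid.const_mul c))
  subst hb
  have h2 : (fun _ : ℝ => c) =O[𝓝[>] 0] fun s => s ^ 1 :=
    hdiv (h1.congr_left fun s => by ring)
  exact ⟨rfl, rfl, hlim h2 tendsto_const_nhds⟩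

/-- Second-order Taylor coefficients of the exponential of a function. -/
theorem coeff_eq_of_isBigO_exp {p₀ p₁ p₂ q₀ q₁ q₂ : ℝ} {Q : ℝ → ℝ}
    (hQ : (fun s => Q s - (q₀ + q₁ * s + q₂ * s ^ 2)) =O[𝓝[>] 0] fun s => s ^ 3)
    (hp : (fun s => Real.exp (Q s) - (p₀ + p₁ * s + p₂ * s ^ 2)) =O[𝓝[>] 0] fun s => s ^ 3) :
    p₀ = Real.exp q₀ ∧ p₁ = Real.exp q₀ * q₁ ∧ p₂ = Real.exp q₀ * (q₂ + q₁ ^ 2 / 2) := by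
  have hid : Tendsto (fun s : ℝ => s) (𝓝[>] 0) (𝓝 0) := tendsto_id.mono_left nhdsWithin_le_nhds
  have hpow : ∀ {j k : ℕ}, j ≤ k →
      (fun s : ℝ => s ^ k) =O[𝓝[>] 0] fun s => s ^ j := fun hjk =>
    Asymptotics.IsBigO.of_bound 1 (by
      filter_upwards [hid.eventually (gt_mem_nhds one_pos), self_mem_nhdsWithin]
        with s h1 (h0 : 0 < s)
      rw [one_mul, norm_pow, norm_pow, Real.norm_eq_abs, abs_of_pos h0]
      exact pow_le_pow_of_le_one h0.le h1.le hjk)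
  set w : ℝ → ℝ := fun s => Q s - q₀
  have hw2 : (fun s => w s - q₁ * s) =O[𝓝[>] 0] fun s => s ^ 2 := by
    have := (hQ.trans (hpow (show 2 ≤ 3 by norm_num))).add
      ((Asymptotics.isBigO_refl (fun s : ℝ => s ^ 2) (𝓝[>] 0)).const_mul_left q₂)
    exact this.congr_left fun s => by simp only [w]; ring
  have hlin : ∀ q : ℝ, (fun s : ℝ => q * s) =O[𝓝[>] 0] fun s => s ^ 1 := fun q =>
    ((Asymptotics.isBigO_refl (fun s : ℝ => s ^ 1) (𝓝[>] 0)).const_mul_left q).congr_left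
      fun s => by ring
  have hw1 : w =O[𝓝[>] 0] fun s => s ^ 1 :=
    ((hw2.trans (hpow (show 1 ≤ 2 by norm_num))).add (hlin q₁)).congr_left fun s => by ring
  have hw0 : Tendsto w (𝓝[>] 0) (𝓝 0) := hw1.trans_tendsto (by simpa using hid)
  have hexp : (fun s => Real.exp (w s) - (1 + w s + w s ^ 2 / 2)) =O[𝓝[>] 0] fun s => s ^ 3 := by
    have h1 := (Real.exp_sub_sum_range_isBigO_pow 3).comp_tendsto hw0
    have h2 := h1.trans (hw1.pow 3)
    refine (h2.congr_left fun s => ?_).congr_right fun s => by ring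
    simp [Finset.sum_range_succ, Nat.factorial]
  -- Difference of squares: `w - q₁ s` is `O(s^2)` and `w + q₁ s` is `O(s)`.
  have hsq : (fun s => w s ^ 2 - (q₁ * s) ^ 2) =O[𝓝[>] 0] fun s => s ^ 3 := by
    have := hw2.mul (hw1.add (hlin q₁))
    exact (this.congr_left fun s => by ring).congr_right fun s => by ring
  have hE : (fun s => Real.exp (Q s) - Real.exp q₀ * (1 + q₁ * s + (q₂ + q₁ ^ 2 / 2) * s ^ 2))
      =O[𝓝[>] 0] fun s => s ^ 3 := by
    have := ((hexp.add hQ).add (hsq.const_mul_left (1 / 2))).const_mul_left (Real.exp q₀)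
    refine this.congr_left fun s => ?_
    have : Real.exp (Q s) = Real.exp q₀ * Real.exp (w s) := by
      rw [← Real.exp_add]; simp [w]
    rw [this]
    simp only [w]
    ring
  have := eq_zero_of_isBigO_quadratic (a := p₀ - Real.exp q₀) (b := p₁ - Real.exp q₀ * q₁)
    (c := p₂ - Real.exp q₀ * (q₂ + q₁ ^ 2 / 2))
    ((hE.sub hp).congr_left fun s => by ring)
  exact ⟨sub_eq_zero.1 this.1, sub_eq_zero.1 this.2.1, sub_eq_zero.1 this.2.2⟩

/-- A bound valid for every `x`, so that the remainder can be controlled uniformly under the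
integral in `logPGF_expansion`. -/
theorem abs_exp_sub_quadratic_le (x : ℝ) :
    |Real.exp x - (1 + x + x ^ 2 / 2)| ≤ |x| ^ 3 * Real.exp |x| := by
  have h := Complex.norm_exp_sub_sum_le_norm_mul_exp (x : ℂ) 3
  rw [Complex.norm_real, Real.norm_eq_abs] at h
  rw [← Real.norm_eq_abs, ← Complex.norm_real]
  convert! h using 2
  simp [Finset.sum_range_succ, Nat.factorial]

end Taylor

/-! ### Volumes of lenses and polar coordinates -/

section Lens

variable {n : ℕ} [NeZero n]

theorem lensVolume_nonneg (r rd x : ℝ) : 0 ≤ lensVolume n r rd x := measureReal_nonneg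

theorem lensVolume_le (r rd x : ℝ) :
    lensVolume n r rd x ≤ (volume : Measure (Space n)).real (Metric.closedBall 0 r) :=
  measureReal_mono inter_subset_left measure_closedBall_lt_top.ne

theorem lensVolume_eq_zero {r rd x : ℝ} (hx : r + rd < x) : lensVolume n r rd x = 0 := by
  rw [lensVolume]
  have : Metric.closedBall (0 : Space n) r ∩ Metric.closedBall (EuclideanSpace.single 0 x) rd
      = ∅ := by
    refine (Metric.closedBall_disjoint_closedBall ?_).inter_eq
    rw [dist_zero_left, PiLp.norm_single, Real.norm_eq_abs]
    exact hx.trans_le (le_abs_self x)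
  rw [this, measureReal_empty]

/-- The lenses are the sections of one closed subset of `ℝ × Space n`. -/
theorem measurable_lensVolume (r rd : ℝ) : Measurable (lensVolume n r rd) := by
  have hs : MeasurableSet {p : ℝ × Space n |
      dist p.2 0 ≤ r ∧ dist p.2 (EuclideanSpace.single 0 p.1) ≤ rd} := by
    refine IsClosed.measurableSet ?_
    have hc : Continuous fun x : ℝ => (EuclideanSpace.single 0 x : Space n) :=
      (PiLp.continuous_toLp 2 (fun _ : Fin n => ℝ)).comp
        (continuous_single (A := fun _ : Fin n => ℝ) 0)
    exact (isClosed_le (continuous_snd.dist continuous_const) continuous_const).inter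
      (isClosed_le (continuous_snd.dist (hc.comp continuous_fst)) continuous_const)
  exact (measurable_measure_prodMk_left (ν := (volume : Measure (Space n))) hs).ennreal_toReal

/-- The lens of two balls depends on the centres only through their distance. -/
theorem measureReal_inter_closedBall (v : Space n) (r rd : ℝ) :
    (volume : Measure (Space n)).real (Metric.closedBall v r ∩ Metric.closedBall 0 rd)
      = lensVolume n r rd ‖v‖ := by
  set e : Space n := EuclideanSpace.single 0 ‖v‖ with he
  have hnorm : ‖v‖ = ‖e‖ := by simp [he]
  -- The reflection carries `v` to `e`, so the isometry `y ↦ e - ρ y` sends `v` to `0` and `0` to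
  -- `e`, matching both centres at once.
  set ρ := (ℝ ∙ (v - e))ᗮ.reflection
  have hρ : ρ v = e := Submodule.reflection_sub hnorm
  have hT : MeasurePreserving (fun y => e - ρ y) (volume : Measure (Space n)) volume :=
    (Measure.measurePreserving_sub_left volume e).comp ρ.measurePreserving
  rw [lensVolume, measureReal_def, measureReal_def, ← he, ← hT.measure_preimage
    (s := Metric.closedBall 0 r ∩ Metric.closedBall e rd)
    (measurableSet_closedBall.inter measurableSet_closedBall).nullMeasurableSet]
  congr 2
  ext y
  simp only [mem_inter_iff, mem_preimage, mem_closedBall_iff_norm, sub_zero,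
    sub_sub_cancel_left, norm_neg, ρ.norm_map]
  rw [← hρ, ← map_sub, ρ.norm_map, norm_sub_rev]

theorem daughterIntensity_real_preimage {ld : ℝ} (hld : 0 ≤ ld) (r rd : ℝ) (x u : Space n) :
    (daughterIntensity n ld rd).real ((fun y => x + y) ⁻¹' Metric.closedBall u r)
      = ld * lensVolume n r rd ‖x - u‖ := by
  have : (fun y => x + y) ⁻¹' Metric.closedBall u r = Metric.closedBall (u - x) r := by
    ext y
    simp only [mem_preimage, mem_closedBall_iff_norm]
    congr! 2
    abel
  rw [this, daughterIntensity, measureReal_ennreal_smul_apply, ENNReal.toReal_ofReal hld,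
    measureReal_restrict_apply measurableSet_closedBall, measureReal_inter_closedBall,
    norm_sub_rev]

theorem volume_real_unit_ball : (volume : Measure (Space n)).real (Metric.ball 0 1)
    = unitBallVolume n := by
  have : Nonempty (Fin n) := ⟨0⟩
  rw [measureReal_def, EuclideanSpace.volume_ball, unitBallVolume]
  have hg : 0 < Real.Gamma ((n : ℝ) / 2 + 1) := Real.Gamma_pos_of_pos (by positivity)
  rw [Fintype.card_fin, ENNReal.ofReal_one, one_pow, one_mul,
    ENNReal.toReal_ofReal (by positivity), Real.sqrt_eq_rpow, ← Real.rpow_natCast,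
    ← Real.rpow_mul Real.pi_pos.le]
  congr 2
  ring

/-- Integration in polar coordinates of a radial function about `u`. -/
theorem integral_fun_norm_sub {φ : ℝ → ℝ} {R : ℝ} (hR : 0 ≤ R) (hφ : ∀ t, R < t → φ t = 0)
    (u : Space n) : ∫ x : Space n, φ ‖x - u‖
      = n * unitBallVolume n * ∫ t in (0 : ℝ)..R, φ t * t ^ (n - 1) := by
  have : Nontrivial (Space n) := by
    have : Nonempty (Fin n) := ⟨0⟩
    infer_instance
  rw [integral_sub_right_eq_self (fun x : Space n => φ ‖x‖) u, integral_fun_norm_addHaar,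
    volume_real_unit_ball, finrank_euclideanSpace_fin, intervalIntegral.integral_of_le hR,
    nsmul_eq_mul, smul_eq_mul, mul_assoc]
  congr 2
  rw [setIntegral_eq_of_subset_of_forall_sdiff_eq_zero (s := Ioc 0 R) measurableSet_Ioi
    Ioc_subset_Ioi_self]
  · simp only [smul_eq_mul, mul_comm]
  · intro t ht
    rw [hφ t (not_le.1 fun h => ht.2 ⟨ht.1, h⟩), smul_zero]

theorem intervalIntegrable_lensVolume {r rd : ℝ} {ψ : ℝ → ℝ} (hψ : Continuous ψ) (ld a b : ℝ) :
    IntervalIntegrable (fun x => ψ (ld * lensVolume n r rd x) * x ^ (n - 1)) volume a b := by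
  have hm : Measurable fun x => ψ (ld * lensVolume n r rd x) :=
    hψ.measurable.comp ((measurable_lensVolume r rd).const_mul ld)
  set A := (volume : Measure (Space n)).real (Metric.closedBall 0 r)
  obtain ⟨C, hC⟩ := (isCompact_Icc (a := (0 : ℝ)) (b := A)).exists_bound_of_continuousOn
    (f := fun y => ψ (ld * y)) (by fun_prop)
  refine IntervalIntegrable.mul_continuousOn ?_ (by fun_prop)
  refine (intervalIntegrable_const (c := C)).mono_fun hm.aestronglyMeasurable
    (ae_of_all _ fun x => ?_)
  exact (hC _ ⟨lensVolume_nonneg _ _ _, lensVolume_le _ _ _⟩).trans (le_abs_self C)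

end Lens

/-! ### Expansion of the log generating function -/

section Exponent

variable {n : ℕ} [NeZero n]

/-- The logarithm of the probability generating function of the number of points in a ball of
radius `r`. -/
def logPGF (n : ℕ) [NeZero n] (lp ld rd r s : ℝ) : ℝ :=
  -(lp * (n * unitBallVolume n * ∫ t in (0 : ℝ)..(r + rd),
    (1 - Real.exp (-(ld * lensVolume n r rd t * (1 - s)))) * t ^ (n - 1)))

/-- The part of the integrand free of `s` integrates to `(r + rd)^n / n`, and `exp(s a)` is expanded
to second order inside the other part. The remainder is `O(s^3)` uniformly in `t` because the lens
volume is bounded by that of a ball. -/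
theorem logPGF_expansion {lp ld rd r : ℝ} (hr : 0 ≤ r) (hrd : 0 ≤ rd) :
    (fun s => logPGF n lp ld rd r s - (hCoeff n lp ld rd 0 r
        - lp * unitBallVolume n * (r + rd) ^ n + hCoeff n lp ld rd 1 r * s
        + hCoeff n lp ld rd 2 r * s ^ 2)) =O[𝓝[>] 0] fun s => s ^ 3 := by
  have hR : 0 ≤ r + rd := add_nonneg hr hrd
  set A := |ld| * (volume : Measure (Space n)).real (Metric.closedBall 0 r)
  set M := lp * n * unitBallVolume n
  set a : ℝ → ℝ := fun t => ld * lensVolume n r rd t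
  have hA : ∀ t, |a t| ≤ A := fun t => by
    simp only [a]
    rw [abs_mul, abs_of_nonneg (lensVolume_nonneg r rd t)]
    exact mul_le_mul_of_nonneg_left (lensVolume_le _ _ _) (abs_nonneg _)
  have hn : (n : ℝ) ≠ 0 := by exact_mod_cast NeZero.ne n
  have hpow : ∫ t in (0 : ℝ)..(r + rd), t ^ (n - 1) = (r + rd) ^ n / n := by
    rw [integral_pow, Nat.sub_add_cancel (NeZero.one_le)]
    have : ((n - 1 : ℕ) : ℝ) + 1 = n := by
      rw [← Nat.cast_add_one, Nat.sub_add_cancel (NeZero.one_le)]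
    rw [this, zero_pow (NeZero.ne n), sub_zero]
  have hint : ∀ ψ : ℝ → ℝ, Continuous ψ →
      IntervalIntegrable (fun t => ψ (a t) * t ^ (n - 1)) volume 0 (r + rd) :=
    fun ψ hψ => intervalIntegrable_lensVolume hψ ld 0 (r + rd)
  have hmono : IntervalIntegrable (fun t : ℝ => t ^ (n - 1)) volume 0 (r + rd) :=
    intervalIntegral.intervalIntegrable_pow _
  have key : ∀ s, logPGF n lp ld rd r s - (hCoeff n lp ld rd 0 r
        - lp * unitBallVolume n * (r + rd) ^ n + hCoeff n lp ld rd 1 r * s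
        + hCoeff n lp ld rd 2 r * s ^ 2)
      = M * ∫ t in (0 : ℝ)..(r + rd), Real.exp (-a t) *
          (Real.exp (s * a t) - (1 + s * a t + (s * a t) ^ 2 / 2)) * t ^ (n - 1) := by
    intro s
    have e1 : ∫ t in (0 : ℝ)..(r + rd), Real.exp (-a t) *
          (Real.exp (s * a t) - (1 + s * a t + (s * a t) ^ 2 / 2)) * t ^ (n - 1)
        = (∫ t in (0 : ℝ)..(r + rd), Real.exp (-(a t * (1 - s))) * t ^ (n - 1))
          - (∫ t in (0 : ℝ)..(r + rd), a t ^ 0 * Real.exp (-a t) * t ^ (n - 1))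
          - s * (∫ t in (0 : ℝ)..(r + rd), a t ^ 1 * Real.exp (-a t) * t ^ (n - 1))
          - s ^ 2 / 2 * ∫ t in (0 : ℝ)..(r + rd), a t ^ 2 * Real.exp (-a t) * t ^ (n - 1) := by
      have i1 := hint (fun y => Real.exp (-(y * (1 - s)))) (by fun_prop)
      have i2 := fun k : ℕ => hint (fun y => y ^ k * Real.exp (-y)) (by fun_prop)
      rw [← intervalIntegral.integral_const_mul, ← intervalIntegral.integral_const_mul,
        ← intervalIntegral.integral_sub i1 (i2 0),
        ← intervalIntegral.integral_sub (i1.sub (i2 0)) ((i2 1).const_mul s),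
        ← intervalIntegral.integral_sub ((i1.sub (i2 0)).sub ((i2 1).const_mul s))
          ((i2 2).const_mul (s ^ 2 / 2))]
      refine intervalIntegral.integral_congr fun t _ => ?_
      have : Real.exp (-(a t * (1 - s))) = Real.exp (-a t) * Real.exp (s * a t) := by
        rw [← Real.exp_add]; congr 1; ring
      simp only [this]
      ring
    have e2 : ∫ t in (0 : ℝ)..(r + rd), (1 - Real.exp (-(a t * (1 - s)))) * t ^ (n - 1)
        = (r + rd) ^ n / n
          - ∫ t in (0 : ℝ)..(r + rd), Real.exp (-(a t * (1 - s))) * t ^ (n - 1) := by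
      rw [← hpow, ← intervalIntegral.integral_sub hmono
        (hint (fun y => Real.exp (-(y * (1 - s)))) (by fun_prop))]
      refine intervalIntegral.integral_congr fun t _ => ?_
      ring
    have hk : ∀ k, hCoeff n lp ld rd k r = M / (k.factorial : ℝ) *
        ∫ t in (0 : ℝ)..(r + rd), a t ^ k * Real.exp (-a t) * t ^ (n - 1) := fun k => rfl
    have hl : logPGF n lp ld rd r s = -(lp * (n * unitBallVolume n * ((r + rd) ^ n / n
        - ∫ t in (0 : ℝ)..(r + rd), Real.exp (-(a t * (1 - s))) * t ^ (n - 1)))) := by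
      rw [← e2]; rfl
    rw [e1, hl, hk, hk, hk]
    generalize (∫ t in (0 : ℝ)..(r + rd), Real.exp (-(a t * (1 - s))) * t ^ (n - 1)) = J
    generalize (∫ t in (0 : ℝ)..(r + rd), a t ^ 0 * Real.exp (-a t) * t ^ (n - 1)) = I₀
    generalize (∫ t in (0 : ℝ)..(r + rd), a t ^ 1 * Real.exp (-a t) * t ^ (n - 1)) = I₁
    generalize (∫ t in (0 : ℝ)..(r + rd), a t ^ 2 * Real.exp (-a t) * t ^ (n - 1)) = I₂
    simp only [M, Nat.factorial]
    field_simp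
    push_cast
    ring
  simp only [key]
  refine Asymptotics.IsBigO.const_mul_left ?_ M
  -- With `|a t| ≤ A` and `s < 1`: `exp A` bounds `exp(-a t)`, `A^3 exp A` comes from the Taylor
  -- remainder, and the last factor is the length of the interval.
  refine Asymptotics.IsBigO.of_bound
    (Real.exp A * (A ^ 3 * Real.exp A) * (r + rd) ^ (n - 1) * |r + rd - 0|) ?_
  have hid : Tendsto (fun s : ℝ => s) (𝓝[>] 0) (𝓝 0) := tendsto_id.mono_left nhdsWithin_le_nhds
  filter_upwards [hid.eventually (gt_mem_nhds one_pos), self_mem_nhdsWithin] with s h1 (h0 : 0 < s)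
  have hbound := intervalIntegral.norm_integral_le_of_norm_le_const (a := (0 : ℝ)) (b := r + rd)
    (C := Real.exp A * (A ^ 3 * Real.exp A) * (r + rd) ^ (n - 1) * s ^ 3)
    (f := fun t => Real.exp (-a t) *
          (Real.exp (s * a t) - (1 + s * a t + (s * a t) ^ 2 / 2)) * t ^ (n - 1)) (by
      intro t ht
      rw [uIoc_of_le hR] at ht
      have hAt := hA t
      have hsA : |s * a t| ≤ s * A := by
        rw [abs_mul, abs_of_pos h0]
        exact mul_le_mul_of_nonneg_left hAt h0.le
      have hA0 : 0 ≤ A := (abs_nonneg _).trans hAt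
      have b1 : ‖Real.exp (-a t)‖ ≤ Real.exp A := by
        rw [Real.norm_eq_abs, Real.abs_exp]
        exact Real.exp_le_exp.2 ((neg_le_abs _).trans hAt)
      have b2 : ‖Real.exp (s * a t) - (1 + s * a t + (s * a t) ^ 2 / 2)‖
          ≤ (s * A) ^ 3 * Real.exp A := by
        refine (abs_exp_sub_quadratic_le _).trans ?_
        refine mul_le_mul (pow_le_pow_left₀ (abs_nonneg _) hsA 3) (Real.exp_le_exp.2
          (hsA.trans (mul_le_of_le_one_left hA0 h1.le))) (Real.exp_pos _).le (by positivity)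
      have b3 : ‖t ^ (n - 1)‖ ≤ (r + rd) ^ (n - 1) := by
        rw [norm_pow, Real.norm_eq_abs, abs_of_pos ht.1]
        exact pow_le_pow_left₀ ht.1.le ht.2 _
      rw [norm_mul, norm_mul]
      calc _ ≤ Real.exp A * ((s * A) ^ 3 * Real.exp A) * (r + rd) ^ (n - 1) := by gcongr
        _ = _ := by ring)
  refine hbound.trans (le_of_eq ?_)
  rw [Real.norm_eq_abs, abs_of_pos (pow_pos h0 3)]
  ring

end Exponent

/-! ### Contact distances and counts in balls -/

section ContactDistance

variable {n : ℕ} {Ω : Type*} [MeasurableSpace Ω] {P : Measure Ω} {lp ld rd : ℝ}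
  {Φ : Ω → Measure (Space n)}

/-- The infimum is attained: closed balls of radius decreasing to `r` intersect in the closed ball
of radius `r`, and the measure is continuous from above since it is finite on balls. -/
theorem contactDistance_le_iff {Ω : Type*} {Φ : Ω → Measure (Space n)} {u : Space n} {ω : Ω}
    (hfin : ∀ r : ℝ, Φ ω (Metric.closedBall u r) ≠ ∞) {r : ℝ} (hr : 0 ≤ r) (k : ℕ) :
    contactDistance Φ u k ω ≤ ENNReal.ofReal r ↔ (k : ℝ≥0∞) ≤ Φ ω (Metric.closedBall u r) := by
  constructor
  · intro h
    have hgt : ∀ r', r < r' → (k : ℝ≥0∞) ≤ Φ ω (Metric.closedBall u r') := by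
      intro r' hr'
      have hlt : contactDistance Φ u k ω < ENNReal.ofReal r' :=
        h.trans_lt ((ENNReal.ofReal_lt_ofReal_iff (hr.trans_lt hr')).2 hr')
      obtain ⟨ρ, hρ⟩ := iInf_lt_iff.1 hlt
      obtain ⟨hk, hρ⟩ := iInf_lt_iff.1 hρ
      refine hk.trans (measure_mono (Metric.closedBall_subset_closedBall ?_))
      have := (ENNReal.lt_ofReal_iff_toReal_lt ENNReal.coe_ne_top).1 hρ
      exact this.le
    have hT : Tendsto (fun m : ℕ => Φ ω (Metric.closedBall u (r + 1 / ((m : ℝ) + 1)))) atTop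
        (𝓝 (Φ ω (⋂ m : ℕ, Metric.closedBall u (r + 1 / ((m : ℝ) + 1))))) := by
      refine tendsto_measure_iInter_atTop
        (fun m => measurableSet_closedBall.nullMeasurableSet) ?_ ⟨0, hfin _⟩
      intro i j hij
      refine Metric.closedBall_subset_closedBall ?_
      have := Nat.one_div_le_one_div (α := ℝ) hij
      linarith
    have hI : ⋂ m : ℕ, Metric.closedBall u (r + 1 / ((m : ℝ) + 1)) = Metric.closedBall u r := by
      ext y
      simp only [mem_iInter, Metric.mem_closedBall]
      refine ⟨fun hy => ?_, fun hy m => hy.trans (le_add_of_nonneg_right (by positivity))⟩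
      have hlim := (tendsto_const_nhds (x := r)).add
        (tendsto_one_div_add_atTop_nhds_zero_nat (𝕜 := ℝ))
      rw [add_zero] at hlim
      exact ge_of_tendsto' hlim hy
    rw [hI] at hT
    exact ge_of_tendsto' hT fun m => hgt _ (lt_add_of_pos_right r (by positivity))
  · intro h
    refine iInf₂_le_of_le r.toNNReal ?_ le_rfl
    rwa [Real.coe_toNNReal r hr]

/-- Counts increase with the radius, so the infimum may be taken over the countably many rational
radii. -/
theorem IsMaternClusterProcess.aemeasurable_contactDistance
    (hΦ : IsMaternClusterProcess P lp ld rd Φ) (u : Space n) (k : ℕ) :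
    AEMeasurable (contactDistance Φ u k) P := by
  have h : contactDistance Φ u k = fun ω => ⨅ q : ℚ,
      if (k : ℝ≥0∞) ≤ Φ ω (Metric.closedBall u (Real.toNNReal q)) then (Real.toNNReal q : ℝ≥0∞)
        else ∞ := by
    ext ω
    refine le_antisymm (le_iInf fun q => ?_) ?_
    · split_ifs with hq
      · exact iInf₂_le (Real.toNNReal q) hq
      · exact le_top
    · refine le_iInf₂ fun ρ hρ => le_of_forall_gt_imp_ge_of_dense fun x hx => ?_
      obtain ⟨q, -, hq1, hq2⟩ := ENNReal.lt_iff_exists_rat_btwn.1 hx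
      refine (iInf_le _ q).trans ?_
      rw [if_pos]
      · exact hq2.le
      · exact hρ.trans (measure_mono (Metric.closedBall_subset_closedBall
          (by exact_mod_cast hq1.le)))
  rw [h]
  refine AEMeasurable.iInf fun q => ?_
  have hm : Measurable fun x : ℝ≥0∞ => if (k : ℝ≥0∞) ≤ x then (Real.toNNReal q : ℝ≥0∞) else ∞ :=
    Measurable.ite measurableSet_Ici measurable_const measurable_const
  exact hm.comp_aemeasurable (hΦ.aemeasurable measurableSet_closedBall)

theorem IsMaternClusterProcess.contactCDF_eq
    (hΦ : IsMaternClusterProcess P lp ld rd Φ) (u : Space n) (k : ℕ) {r : ℝ} (hr : 0 ≤ r) :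
    contactCDF P Φ u k r = P.real {ω | (k : ℝ≥0∞) ≤ Φ ω (Metric.closedBall u r)} := by
  -- Almost everywhere measurability matters here: otherwise `Measure.map` would be the zero measure
  -- by convention.
  rw [contactCDF, map_measureReal_apply_of_aemeasurable
    (hΦ.aemeasurable_contactDistance u k) measurableSet_Iic]
  refine measureReal_congr ?_
  filter_upwards [hΦ.counting] with ω hω
  refine propext (contactDistance_le_iff (fun r' => ?_) hr k)
  obtain ⟨m, hm⟩ := hω u r'
  exact hm ▸ ENNReal.natCast_ne_top m

end ContactDistance

/-! ### Counts of at most two points and generating functions -/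

section GeneratingFunction

variable {Ω : Type*} [MeasurableSpace Ω] {P : Measure Ω} [IsProbabilityMeasure P]

/-- The probability generating function of a random natural number, to second order. -/
theorem abs_integral_exp_sub_le {Y : Ω → ℝ≥0∞} (hY : AEMeasurable Y P)
    (hn : ∀ᵐ ω ∂P, ∃ m : ℕ, Y ω = m) {s : ℝ} (h0 : 0 < s) (h1 : s < 1) :
    |∫ ω, Real.exp (-(ENNReal.ofReal (-Real.log s) * Y ω).toReal) ∂P
      - (P.real {ω | Y ω = 0} + P.real {ω | Y ω = 1} * s + P.real {ω | Y ω = 2} * s ^ 2)|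
      ≤ s ^ 3 := by
  have hms : ∀ x : ℝ≥0∞, NullMeasurableSet {ω | Y ω = x} P := fun x =>
    hY.nullMeasurable (measurableSet_singleton x)
  have hI : ∀ (x : ℝ≥0∞) (a : ℝ), Integrable ({ω | Y ω = x}.indicator fun _ => a) P := fun x a =>
    (integrable_const a).indicator₀ (hms x)
  have hInt : ∀ (x : ℝ≥0∞) (a : ℝ), ∫ ω, ({ω | Y ω = x}.indicator fun _ => a) ω ∂P
      = P.real {ω | Y ω = x} * a := fun x a => by
    rw [integral_indicator₀ (hms x), setIntegral_const, smul_eq_mul]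
  have hE : Integrable
      (fun ω => Real.exp (-(ENNReal.ofReal (-Real.log s) * Y ω).toReal)) P :=
    Integrable.of_bound (hY.const_mul _).ennreal_toReal.neg.exp.aestronglyMeasurable 1
      (ae_of_all _ fun ω => norm_exp_neg_toReal_le_one _)
  have hI2 : Integrable (fun ω => ({ω | Y ω = 0}.indicator fun _ => (1 : ℝ)) ω
      + ({ω | Y ω = 1}.indicator fun _ => s) ω) P := (hI 0 1).add (hI 1 s)
  have hI3 : Integrable (fun ω => ({ω | Y ω = 0}.indicator fun _ => (1 : ℝ)) ω
      + ({ω | Y ω = 1}.indicator fun _ => s) ω + ({ω | Y ω = 2}.indicator fun _ => s ^ 2) ω) P :=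
    hI2.add (hI 2 (s ^ 2))
  rw [show P.real {ω | Y ω = 0} = P.real {ω | Y ω = 0} * 1 by ring, ← hInt, ← hInt, ← hInt,
    ← integral_add (hI 0 1) (hI 1 s), ← integral_add hI2 (hI 2 (s ^ 2)),
    ← integral_sub hE hI3, ← Real.norm_eq_abs]
  refine (norm_integral_le_of_norm_le_const (C := s ^ 3) ?_).trans (by simp)
  filter_upwards [hn] with ω ⟨m, hm⟩
  have hlog : 0 ≤ -Real.log s := neg_nonneg.2 (Real.log_nonpos h0.le h1.le)
  -- The parameter `-log s` turns the Laplace transform into `s ^ m`; only `m ≥ 3` leaves an error,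
  -- which is then at most `s ^ 3`.
  have hexp : Real.exp (-(ENNReal.ofReal (-Real.log s) * Y ω).toReal) = s ^ m := by
    rw [hm, ENNReal.toReal_mul, ENNReal.toReal_ofReal hlog, ENNReal.toReal_natCast,
      neg_mul, neg_neg, mul_comm, Real.exp_nat_mul, Real.exp_log h0]
  rw [hexp]
  simp only [indicator, mem_ofPred_eq, hm]
  have hc : ∀ j : ℕ, ((m : ℝ≥0∞) = j) ↔ m = j := fun j => Nat.cast_inj
  have hc0 := hc 0
  have hc1 := hc 1
  have hc2 := hc 2
  push_cast at hc0 hc1 hc2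
  simp only [hc0, hc1, hc2]
  have hs3 : 0 ≤ s ^ 3 := by positivity
  match m with
  | 0 => simpa using hs3
  | 1 => simpa using hs3
  | 2 => simpa using hs3
  | j + 3 =>
    rw [if_neg (by omega), if_neg (by omega), if_neg (by omega), add_zero, add_zero, sub_zero,
      Real.norm_eq_abs, abs_of_pos (pow_pos h0 _)]
    exact pow_le_pow_of_le_one h0.le h1.le (by omega)

/-- Tail probabilities of a random natural number. -/
theorem measureReal_natCast_le_eq {Y : Ω → ℝ≥0∞} (hY : AEMeasurable Y P)
    (hn : ∀ᵐ ω ∂P, ∃ m : ℕ, Y ω = m) (k : ℕ) :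
    P.real {ω | (k : ℝ≥0∞) ≤ Y ω}
      = P.real {ω | ((k + 1 : ℕ) : ℝ≥0∞) ≤ Y ω} + P.real {ω | Y ω = k} := by
  have hm : NullMeasurableSet {ω | ((k + 1 : ℕ) : ℝ≥0∞) ≤ Y ω} P :=
    hY.nullMeasurable measurableSet_Ici
  rw [← measureReal_union₀' hm]
  · refine measureReal_congr ?_
    filter_upwards [hn] with ω ⟨m, hm⟩
    refine propext ?_
    change (k : ℝ≥0∞) ≤ Y ω ↔ ((k + 1 : ℕ) : ℝ≥0∞) ≤ Y ω ∨ Y ω = k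
    rw [hm, Nat.cast_le, Nat.cast_le, Nat.cast_inj]
    omega
  · refine Disjoint.aedisjoint (disjoint_left.2 fun ω h1 h2 => ?_)
    rw [mem_ofPred_eq] at h1 h2
    rw [h2, Nat.cast_le] at h1
    omega

end GeneratingFunction

/-! ### Count probabilities and the contact distributions -/

section Main

variable {n : ℕ} [NeZero n] {Ω : Type*} [MeasurableSpace Ω] {P : Measure Ω}
  [IsProbabilityMeasure P] {lp ld rd : ℝ} {Φ : Ω → Measure (Space n)}

theorem IsMaternClusterProcess.integral_exp_eq_exp_logPGF
    (hΦ : IsMaternClusterProcess P lp ld rd Φ) (hlp : 0 ≤ lp) (hld : 0 ≤ ld) (hrd : 0 ≤ rd)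
    (u : Space n) {r : ℝ} (hr : 0 ≤ r) {s : ℝ} (h0 : 0 < s) (h1 : s < 1) :
    ∫ ω, Real.exp (-(ENNReal.ofReal (-Real.log s) * Φ ω (Metric.closedBall u r)).toReal) ∂P
      = Real.exp (logPGF n lp ld rd r s) := by
  have hlog : 0 ≤ -Real.log s := neg_nonneg.2 (Real.log_nonpos h0.le h1.le)
  rw [hΦ.laplace u r ENNReal.ofReal_ne_top, ENNReal.toReal_ofReal hlog, neg_neg,
    Real.exp_log h0, integral_smul_measure, ENNReal.toReal_ofReal hlp, smul_eq_mul, logPGF]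
  simp only [daughterIntensity_real_preimage hld]
  rw [integral_fun_norm_sub (R := r + rd)
    (φ := fun t => 1 - Real.exp (-(ld * lensVolume n r rd t * (1 - s))))
    (add_nonneg hr hrd) fun t ht => by simp [lensVolume_eq_zero ht]]

/-- The probabilities that a ball contains no, one or two points of a Matérn cluster process. -/
theorem IsMaternClusterProcess.measureReal_count
    (hΦ : IsMaternClusterProcess P lp ld rd Φ) (hlp : 0 ≤ lp) (hld : 0 ≤ ld) (hrd : 0 ≤ rd)
    (u : Space n) {r : ℝ} (hr : 0 ≤ r) :
    let E := Real.exp (hCoeff n lp ld rd 0 r - lp * unitBallVolume n * (r + rd) ^ n)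
    P.real {ω | Φ ω (Metric.closedBall u r) = 0} = E ∧
    P.real {ω | Φ ω (Metric.closedBall u r) = 1} = E * hCoeff n lp ld rd 1 r ∧
    P.real {ω | Φ ω (Metric.closedBall u r) = 2}
      = E * (hCoeff n lp ld rd 2 r + hCoeff n lp ld rd 1 r ^ 2 / 2) := by
  refine coeff_eq_of_isBigO_exp (logPGF_expansion hr hrd) ?_
  have hid : Tendsto (fun s : ℝ => s) (𝓝[>] 0) (𝓝 0) := tendsto_id.mono_left nhdsWithin_le_nhds
  refine Asymptotics.IsBigO.of_bound 1 ?_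
  filter_upwards [hid.eventually (gt_mem_nhds one_pos), self_mem_nhdsWithin] with s h1 (h0 : 0 < s)
  rw [← hΦ.integral_exp_eq_exp_logPGF hlp hld hrd u hr h0 h1, one_mul, Real.norm_eq_abs,
    Real.norm_eq_abs, abs_of_pos (pow_pos h0 3)]
  exact abs_integral_exp_sub_le (hΦ.aemeasurable measurableSet_closedBall)
    (hΦ.counting.mono fun ω h => h u r) h0 h1

end Main

end Matern

end

theorem corollary2 (n : ℕ) [NeZero n] {Ω : Type*} [MeasurableSpace Ω]
    (P : Measure Ω) [IsProbabilityMeasure P]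
    (lp ld rd : ℝ) (hlp : 0 < lp) (hld : 0 < ld) (hrd : 0 < rd)
    (Φ : Ω → Measure (Matern.Space n))
    (hΦ : Matern.IsMaternClusterProcess P lp ld rd Φ)
    (u : Matern.Space n) (r : ℝ) (hr : 0 ≤ r) :
    Matern.contactCDF P Φ u 1 r =
        1 - Real.exp (Matern.hCoeff n lp ld rd 0 r
          - lp * Matern.unitBallVolume n * (r + rd) ^ n) ∧
    Matern.contactCDF P Φ u 2 r =
        1 - Real.exp (Matern.hCoeff n lp ld rd 0 r
          - lp * Matern.unitBallVolume n * (r + rd) ^ n) *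
            (1 + Matern.hCoeff n lp ld rd 1 r) ∧
    Matern.contactCDF P Φ u 3 r =
        Matern.contactCDF P Φ u 2 r
          - Real.exp (Matern.hCoeff n lp ld rd 0 r
            - lp * Matern.unitBallVolume n * (r + rd) ^ n) *
            (Matern.hCoeff n lp ld rd 2 r + Matern.hCoeff n lp ld rd 1 r ^ 2 / 2) := by
  obtain ⟨p0, p1, p2⟩ := hΦ.measureReal_count hlp.le hld.le hrd.le u hr
  have hY := hΦ.aemeasurable (B := Metric.closedBall u r) measurableSet_closedBall
  have htail := Matern.measureReal_natCast_le_eq hY (hΦ.counting.mono fun ω h => h u r)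
  -- The case `k = 0` starts from total probability `1`; each further case removes the probability
  -- of exactly `k` points.
  have t0 := htail 0
  have t1 := htail 1
  have t2 := htail 2
  rw [hΦ.contactCDF_eq u 1 hr, hΦ.contactCDF_eq u 2 hr, hΦ.contactCDF_eq u 3 hr]
  simp only [Nat.cast_zero, Nat.cast_one, Nat.cast_ofNat, zero_le, ofPred_true, probReal_univ,
    zero_add, Nat.reduceAdd, p0, p1, p2] at t0 t1 t2 ⊢
  refine ⟨?_, ?_, ?_⟩ <;> linarith
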